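/- **Theorem (MMD approximation).** There are absolute constants $c>0$ and $C>0$ such that the following holds. Let a discounted Markov decision process have state space $\mathcal S\subseteq\mathbb R^p$, action space $\mathcal A\subseteq\mathbb R^q$, transition probabilities $P(s'\mid s,a)$, a reward function, a discount factor $\gamma\in(0,1)$ and an initial state distribution, and put $d=p+q$. Let $\pi_1,\pi_2$ be two (possibly stochastic) Markov policies, with occupancy measures $\rho_i=(1-\gamma)\sum_{t\ge 0}\gamma^t\,\Pr[(S_t,A_t)\in\cdot\mid\pi_i]$, $i=1,2$. Let $\sigma>0$, let $k(x,y)=\exp\big(-\|x-y\|^2/(2\sigma^2)\big)$ be the Gaussian kernel on $\mathbb R^d$, let $\Phi$ be its canonical feature map into its reproducing kernel Hilbert space, and put $$\mathrm{MMD}(\rho_1,\rho_2)=\big\|\mathbb E_{(s,a)\sim\rho_1}\Phi([s;a])-\mathbb E_{(s,a)\sim\rho_2}\Phi([s;a])\big\|,$$ where $[s;a]\in\mathbb R^d$ is the concatenation of $s$ and $a$. Let $D,n\ge 1$, and let $w_1,\dots,w_D\sim\mathcal N(0,\sigma^{-2}I_d)$, $b_1,\dots,b_D\sim\mathcal U(0,2\pi)$,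 $x_1,\dots,x_n\sim\rho_1$ and $y_1,\dots,y_n\sim\rho_2$ be mutually independent. Define the random Fourier features $$\phi(s,a)=\sqrt{2/D}\,\big(\cos(w_1^{T}[s;a]+b_1),\dots,\cos(w_D^{T}[s;a]+b_D)\big)\in\mathbb R^D$$ and the policy embeddings $\phi_1=\frac1n\sum_{j=1}^n\phi(x_j)$ and $\phi_2=\frac1n\sum_{j=1}^n\phi(y_j)$. Then for every $\varepsilon>0$, $$\Pr\Big[\big|\,\|\phi_1-\phi_2\|_2-\mathrm{MMD}(\rho_1,\rho_2)\big|\ge\tfrac34\varepsilon\Big]\le 2e^{-nc\varepsilon^2}+\frac{C}{\varepsilon^2}\exp\Big(\frac{-D\varepsilon^2}{64(d+2)}\Big)+6e^{-n\varepsilon^2/8}.$$ -/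

import Mathlib

open MeasureTheory ProbabilityTheory
open scoped ENNReal

namespace AutoQD

/-! ### Markov decision processes and occupancy measures -/

/-- A discounted Markov decision process whose states and actions are real vectors: the state space
is a set `S ⊆ ℝ^p` and the action space a set `A ⊆ ℝ^q`, with their Borel σ-algebras. -/
structure MDP {p q : ℕ} (S : Set (EuclideanSpace ℝ (Fin p)))
    (A : Set (EuclideanSpace ℝ (Fin q))) where
  /-- distribution of the initial state -/
  init : Measure S
  isProbabilityMeasure_init : IsProbabilityMeasure init
  /-- transition probabilities `P(s' | s, a)` -/
  trans : Kernel (S × A) S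
  isMarkovKernel_trans : IsMarkovKernel trans
  /-- reward function -/
  reward : S × A → ℝ
  /-- discount factor -/
  γ : ℝ
  γ_pos : 0 < γ
  γ_lt_one : γ < 1

attribute [instance] MDP.isProbabilityMeasure_init MDP.isMarkovKernel_trans

section Occupancy

variable {p q : ℕ} {S : Set (EuclideanSpace ℝ (Fin p))} {A : Set (EuclideanSpace ℝ (Fin q))}

/-- The law of `(S_t, A_t)` when the policy `π` is followed: `S_0` has the initial distribution,
`A_t` is drawn from `π(· | S_t)` and `S_{t+1}` is drawn from `P(· | S_t, A_t)`. -/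
noncomputable def MDP.stateActionLaw (M : MDP S A) (π : Kernel S A) : ℕ → Measure (S × A)
  | 0 => M.init ⊗ₘ π
  | t + 1 => (M.trans ∘ₘ M.stateActionLaw π t) ⊗ₘ π

/-- The occupancy measure `ρ^π = (1 - γ) ∑_t γ^t P(S_t = ·, A_t = · | π)`. -/
noncomputable def MDP.occupancy (M : MDP S A) (π : Kernel S A) : Measure (S × A) :=
  ENNReal.ofReal (1 - M.γ) •
    Measure.sum (fun t : ℕ => ENNReal.ofReal (M.γ ^ t) • M.stateActionLaw π t)

instance (M : MDP S A) (π : Kernel S A) [IsMarkovKernel π] (t : ℕ) :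
    IsProbabilityMeasure (M.stateActionLaw π t) := by
  induction t with
  | zero => rw [MDP.stateActionLaw]; infer_instance
  | succ t ih => rw [MDP.stateActionLaw]; infer_instance

instance (M : MDP S A) (π : Kernel S A) [IsMarkovKernel π] :
    IsProbabilityMeasure (M.occupancy π) := by
  refine ⟨?_⟩
  have h1 : 0 < 1 - M.γ := sub_pos.2 M.γ_lt_one
  simp only [MDP.occupancy, Measure.smul_apply, smul_eq_mul,
    Measure.sum_apply _ MeasurableSet.univ, measure_univ, mul_one]
  rw [← ENNReal.ofReal_tsum_of_nonneg (fun t => pow_nonneg M.γ_pos.le t)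
      (summable_geometric_of_lt_one M.γ_pos.le M.γ_lt_one),
    tsum_geometric_of_lt_one M.γ_pos.le M.γ_lt_one, ← ENNReal.ofReal_mul h1.le,
    mul_inv_cancel₀ h1.ne', ENNReal.ofReal_one]

/-- The concatenation `[s; a] ∈ ℝ^(p+q)` of a state vector and an action vector. -/
def stateActionVec (z : S × A) : EuclideanSpace ℝ (Fin (p + q)) :=
  WithLp.toLp 2 (Fin.append (fun i => (z.1 : EuclideanSpace ℝ (Fin p)) i)
    (fun j => (z.2 : EuclideanSpace ℝ (Fin q)) j))

end Occupancy

/-! ### The Gaussian kernel and the maximum mean discrepancy -/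

/-- The Gaussian kernel `k(x, y) = exp(-‖x - y‖² / (2σ²))` of width `σ`. -/
noncomputable def gaussianKernel {d : ℕ} (σ : ℝ) (x y : EuclideanSpace ℝ (Fin d)) : ℝ :=
  Real.exp (-‖x - y‖ ^ 2 / (2 * σ ^ 2))

/-- The Gaussian kernel as a matrix of operators on `ℝ`, the form in which Mathlib constructs
the reproducing kernel Hilbert space of a kernel. -/
noncomputable def gaussianKernelMatrix (d : ℕ) (σ : ℝ) :
    Matrix (EuclideanSpace ℝ (Fin d)) (EuclideanSpace ℝ (Fin d)) (ℝ →L[ℝ] ℝ) :=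
  Matrix.of fun x y => gaussianKernel σ x y • ContinuousLinearMap.id ℝ ℝ

lemma gaussianKernel_eq_integral {d : ℕ} (σ : ℝ) (x y : EuclideanSpace ℝ (Fin d)) :
    gaussianKernel σ x y = ∫ w, Real.cos (inner ℝ w (σ⁻¹ • x) - inner ℝ w (σ⁻¹ • y))
      ∂(stdGaussian (EuclideanSpace ℝ (Fin d))) := by
  have h := congrArg Complex.re (charFun_stdGaussian (σ⁻¹ • x - σ⁻¹ • y))
  have hint : Integrable (fun w : EuclideanSpace ℝ (Fin d) =>
      Complex.exp (inner ℝ w (σ⁻¹ • x - σ⁻¹ • y) * Complex.I))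
      (stdGaussian (EuclideanSpace ℝ (Fin d))) := by
    refine Integrable.of_bound (by fun_prop) 1 (ae_of_all _ fun w => ?_)
    rw [Complex.norm_exp_ofReal_mul_I]
  rw [charFun_apply] at h
  have h2 := integral_re hint
  simp only [RCLike.re_to_complex] at h2
  rw [← h2] at h
  simp only [Complex.exp_ofReal_mul_I_re, inner_sub_right] at h
  rw [h, gaussianKernel, ← smul_sub, norm_smul, norm_inv, Real.norm_eq_abs]
  have h3 : (-((|σ|⁻¹ * ‖x - y‖ : ℝ) : ℂ) ^ 2 / 2) =
      ((-‖x - y‖ ^ 2 / (2 * σ ^ 2) : ℝ) : ℂ) := by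
    have h4 : -‖x - y‖ ^ 2 / (2 * σ ^ 2) = -(|σ|⁻¹ * ‖x - y‖) ^ 2 / 2 := by
      rw [mul_pow, inv_pow, sq_abs, mul_comm (2 : ℝ), ← div_div]
      ring
    rw [h4]
    push_cast
    ring
  rw [h3, Complex.exp_ofReal_re]

instance gaussianKernelMatrix_posSemidef (d : ℕ) (σ : ℝ) :
    Fact (gaussianKernelMatrix d σ).PosSemidef := by
  refine ⟨((RKHS.posSemidef_tfae (K := gaussianKernelMatrix d σ)).out 0 2 rfl rfl).2
    ⟨?_, fun v => ?_⟩⟩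
  · ext x y
    simp [gaussianKernelMatrix, gaussianKernel, norm_sub_rev x y, Matrix.conjTranspose_apply,
      ContinuousLinearMap.star_eq_adjoint, ContinuousLinearMap.adjoint_id]
  · have key : ∀ x y : EuclideanSpace ℝ (Fin d),
        Integrable (fun w => Real.cos (inner ℝ w (σ⁻¹ • x) - inner ℝ w (σ⁻¹ • y)))
          (stdGaussian (EuclideanSpace ℝ (Fin d))) := fun x y =>
      Integrable.of_bound (by fun_prop) 1 (ae_of_all _ fun w => Real.abs_cos_le_one _)
    have h : (v.sum fun x z => v.sum fun x' z' =>
          inner ℝ (gaussianKernelMatrix d σ x' x z) z') =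
        ∫ w, ((∑ x ∈ v.support, v x * Real.cos (inner ℝ w (σ⁻¹ • x))) ^ 2 +
          (∑ x ∈ v.support, v x * Real.sin (inner ℝ w (σ⁻¹ • x))) ^ 2)
          ∂(stdGaussian (EuclideanSpace ℝ (Fin d))) := by
      have h1 : (v.sum fun x z => v.sum fun x' z' =>
          inner ℝ (gaussianKernelMatrix d σ x' x z) z') =
          ∑ x ∈ v.support, ∑ x' ∈ v.support, (v x * v x') *
            ∫ w, Real.cos (inner ℝ w (σ⁻¹ • x') - inner ℝ w (σ⁻¹ • x))
              ∂(stdGaussian (EuclideanSpace ℝ (Fin d))) := by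
        simp only [Finsupp.sum, ← gaussianKernel_eq_integral]
        refine Finset.sum_congr rfl fun x _ => Finset.sum_congr rfl fun x' _ => ?_
        simp [gaussianKernelMatrix]
        ring
      rw [h1]
      simp_rw [← integral_const_mul]
      simp_rw [← integral_finsetSum _ (fun x' _ => (key x' _).const_mul _)]
      rw [← integral_finsetSum _
        (fun x _ => integrable_finsetSum _ (fun x' _ => (key x' x).const_mul _))]
      refine integral_congr_ae (ae_of_all _ fun w => ?_)
      simp only [sq, Finset.sum_mul_sum, ← Finset.sum_add_distrib, Real.cos_sub]
      refine Finset.sum_congr rfl fun x _ => Finset.sum_congr rfl fun x' _ => ?_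
      ring
    rw [h]
    exact integral_nonneg fun w => by positivity

/-- The canonical feature map `x ↦ k(x, ·)` into the reproducing kernel Hilbert space of the
Gaussian kernel. -/
noncomputable def gaussianFeature {d : ℕ} (σ : ℝ) (x : EuclideanSpace ℝ (Fin d)) :
    RKHS.OfKernel (gaussianKernelMatrix d σ) :=
  RKHS.kerFun (RKHS.OfKernel (gaussianKernelMatrix d σ)) x (1 : ℝ)

lemma inner_gaussianFeature {d : ℕ} (σ : ℝ) (x y : EuclideanSpace ℝ (Fin d)) :
    inner ℝ (gaussianFeature σ x) (gaussianFeature σ y) = gaussianKernel σ x y := by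
  rw [gaussianFeature, gaussianFeature, ← RKHS.kernel_inner, RKHS.OfKernel.kernel_ofKernel]
  simp [gaussianKernelMatrix, gaussianKernel, norm_sub_rev x y]

/-- The maximum mean discrepancy `MMD(P, Q) = ‖E_{X ∼ P} Φ(X) - E_{Y ∼ Q} Φ(Y)‖`, with `Φ` the
feature map of the Gaussian kernel. -/
noncomputable def MMD {d : ℕ} (σ : ℝ) (P Q : Measure (EuclideanSpace ℝ (Fin d))) : ℝ :=
  ‖(∫ x, gaussianFeature σ x ∂P) - ∫ y, gaussianFeature σ y ∂Q‖

/-! ### Random Fourier features and policy embeddings -/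

/-- The `D`-dimensional random Fourier features with frequencies `w_i` and offsets `b_i`:
`φ(x) = √(2/D) (cos(⟨w_1, x⟩ + b_1), …, cos(⟨w_D, x⟩ + b_D))`. -/
noncomputable def fourierFeatures {d D : ℕ} (w : Fin D → EuclideanSpace ℝ (Fin d))
    (b : Fin D → ℝ) (x : EuclideanSpace ℝ (Fin d)) : EuclideanSpace ℝ (Fin D) :=
  WithLp.toLp 2 fun i => √(2 / (D : ℝ)) * Real.cos (inner ℝ (w i) x + b i)

/-- The embedding of a sample `x_1, …, x_n`: the empirical mean of its random Fourier features. -/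
noncomputable def embedding {d D n : ℕ} (w : Fin D → EuclideanSpace ℝ (Fin d))
    (b : Fin D → ℝ) (x : Fin n → EuclideanSpace ℝ (Fin d)) : EuclideanSpace ℝ (Fin D) :=
  (1 / (n : ℝ)) • ∑ j, fourierFeatures w b (x j)

/-- The random draws: frequencies `w_i ∼ 𝒩(0, σ⁻² I)`, offsets `b_i ∼ 𝒰(0, 2π)`, samples
`x_j ∼ ρ₁` and `y_j ∼ ρ₂`, all of them mutually independent. -/
structure IsDraw {Ω 𝓩 : Type*} [MeasurableSpace Ω] [MeasurableSpace 𝓩] {d D n : ℕ} (μ : Measure Ω)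
    (σ : ℝ) (ρ₁ ρ₂ : Measure 𝓩) (w : Fin D → Ω → EuclideanSpace ℝ (Fin d)) (b : Fin D → Ω → ℝ)
    (x y : Fin n → Ω → 𝓩) : Prop where
  measurable_w : ∀ i, Measurable (w i)
  measurable_b : ∀ i, Measurable (b i)
  measurable_x : ∀ j, Measurable (x j)
  measurable_y : ∀ j, Measurable (y j)
  law_w : ∀ i, μ.map (w i) = multivariateGaussian 0 ((σ ^ 2)⁻¹ • (1 : Matrix (Fin d) (Fin d) ℝ))
  law_b : ∀ i, μ.map (b i) = ProbabilityTheory.cond volume (Set.Ioo 0 (2 * Real.pi))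
  law_x : ∀ j, μ.map (x j) = ρ₁
  law_y : ∀ j, μ.map (y j) = ρ₂
  indep : iIndep (Sum.elim
    (Sum.elim (fun i => MeasurableSpace.comap (w i) inferInstance)
      (fun i => MeasurableSpace.comap (b i) inferInstance))
    (Sum.elim (fun j => MeasurableSpace.comap (x j) inferInstance)
      (fun j => MeasurableSpace.comap (y j) inferInstance))) μ

end AutoQD

/-
For fixed random parameters `θ₁, …, θ_D` the distance of the two embeddings is the root mean square
over `i` of the gaps between the sample means of the feature `ψ_{θ_i}`. By the triangle inequality
in `ℝ^D` it differs from the root mean square of the corresponding population gaps by at most the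
root mean square of the sampling errors.

Given `θ`, a sampling error is sub-Gaussian with variance proxy of order `1 / n`, uniformly in `θ`.
Hence its square has a bounded exponential moment, and by convexity so does the mean of the squares,
however the errors depend on each other.

The population gaps are independent, and random Fourier features reproduce the kernel, so that
`MMD²` is the mean of the squared gaps. To avoid a loss when `MMD` is small, the square root is not
linearised: the square root of a sum of independent variables with values in `[0, B]` deviates from
the square root of the mean by `δ` with probability at most `2 exp (-δ² / B)`, whatever the mean is.
No union bound over the sample space is needed, so that `d` does not enter.
-/

namespace AutoQD

section SqrtSum

variable {Ω ι : Type*} [MeasurableSpace Ω] {μ : Measure Ω} [IsProbabilityMeasure μ]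

lemma mgf_le_exp_of_mem_Icc {Z : Ω → ℝ} {B : ℝ} (hB : 0 < B) (hZ : AEMeasurable Z μ)
    (hZB : ∀ᵐ ω ∂μ, Z ω ∈ Set.Icc 0 B) (s : ℝ) :
    mgf Z μ s ≤ Real.exp (μ[Z] * ((Real.exp (s * B) - 1) / B)) := by
  have hint : Integrable Z μ := .of_mem_Icc 0 B hZ hZB
  calc mgf Z μ s ≤ ∫ ω, (Z ω * ((Real.exp (s * B) - 1) / B) + 1) ∂μ := by
        refine integral_mono_ae (integrable_exp_mul_of_mem_Icc hZ hZB)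
          ((hint.mul_const _).add (integrable_const _)) (hZB.mono fun ω hω => ?_)
        have chord := convexOn_exp.2 (Set.mem_univ 0) (Set.mem_univ (s * B))
          (sub_nonneg.2 (div_le_one_of_le₀ hω.2 hB.le)) (div_nonneg hω.1 hB.le) (sub_add_cancel _ _)
        simp only [smul_eq_mul, mul_zero, zero_add, Real.exp_zero, mul_one] at chord
        calc Real.exp (s * Z ω) = Real.exp (Z ω / B * (s * B)) := by congr 1; field_simp
          _ ≤ 1 - Z ω / B + Z ω / B * Real.exp (s * B) := chord
          _ = Z ω * ((Real.exp (s * B) - 1) / B) + 1 := by ring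
    _ = μ[Z] * ((Real.exp (s * B) - 1) / B) + 1 := by
        rw [integral_add (hint.mul_const _) (integrable_const _), integral_mul_const]
        simp
    _ ≤ _ := Real.add_one_le_exp _

-- The Chernoff exponent at the level `u ^ 2` for a sum of mean `r ^ 2`. Evaluating it at
-- `s = log (u / r)` rather than at its minimiser `2 * log (u / r)` already gives a perfect square,
-- and its sign selects the upper tail or the lower one.
lemma exists_mul_exp_sub_one_sub_mul_sq_le {r u : ℝ} (hr : 0 ≤ r) (hu : 0 < u) :
    ∃ s : ℝ, (r ≤ u → 0 ≤ s) ∧ (u ≤ r → s ≤ 0) ∧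
      r ^ 2 * (Real.exp s - 1) - s * u ^ 2 ≤ -(u - r) ^ 2 := by
  obtain rfl | hr := hr.eq_or_lt
  · exact ⟨1, fun _ => zero_le_one, fun h => absurd hu h.not_gt, by simp⟩
  refine ⟨Real.log (u / r), fun h => Real.log_nonneg ((one_le_div hr).2 h),
    fun h => Real.log_nonpos (by positivity) ((div_le_one hr).2 h), ?_⟩
  have hlog : 1 - r / u ≤ Real.log (u / r) := by
    simpa using Real.one_sub_inv_le_log_of_pos (div_pos hu hr)
  calc r ^ 2 * (Real.exp (Real.log (u / r)) - 1) - Real.log (u / r) * u ^ 2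
      ≤ r ^ 2 * (u / r - 1) - (1 - r / u) * u ^ 2 := by
        rw [Real.exp_log (div_pos hu hr)]
        gcongr
    _ = -(u - r) ^ 2 := by
        field_simp
        ring

variable [Fintype ι] {Z : ι → Ω → ℝ} {B : ℝ}

lemma mgf_sum_le_exp_of_mem_Icc (hB : 0 < B) (hind : iIndepFun Z μ) (hZ : ∀ i, Measurable (Z i))
    (hZB : ∀ i ω, Z i ω ∈ Set.Icc 0 B) (s : ℝ) :
    mgf (∑ i, Z i) μ s ≤ Real.exp ((∑ i, μ[Z i]) * ((Real.exp (s * B) - 1) / B)) := by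
  rw [hind.mgf_sum hZ, Finset.sum_mul, Real.exp_sum]
  exact Finset.prod_le_prod (fun _ _ => mgf_nonneg) fun i _ =>
    mgf_le_exp_of_mem_Icc hB (hZ i).aemeasurable (ae_of_all _ (hZB i)) s

lemma exp_mul_mgf_sum_le (hB : 0 < B) (hind : iIndepFun Z μ) (hZ : ∀ i, Measurable (Z i))
    (hZB : ∀ i ω, Z i ω ∈ Set.Icc 0 B) {s u : ℝ}
    (hs : √(∑ i, μ[Z i]) ^ 2 * (Real.exp s - 1) - s * u ^ 2 ≤ -(u - √(∑ i, μ[Z i])) ^ 2) :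
    Real.exp (-(s / B) * u ^ 2) * mgf (∑ i, Z i) μ (s / B) ≤
      Real.exp (-((u - √(∑ i, μ[Z i])) ^ 2 / B)) := by
  refine (mul_le_mul_of_nonneg_left (mgf_sum_le_exp_of_mem_Icc hB hind hZ hZB _)
    (Real.exp_pos _).le).trans ?_
  rw [← Real.exp_add, Real.exp_le_exp, div_mul_cancel₀ _ hB.ne']
  rw [Real.sq_sqrt (Finset.sum_nonneg fun i _ => integral_nonneg fun ω => (hZB i ω).1)] at hs
  calc _ = ((∑ i, μ[Z i]) * (Real.exp s - 1) - s * u ^ 2) / B := by ring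
    _ ≤ -(u - √(∑ i, μ[Z i])) ^ 2 / B := by gcongr
    _ = _ := neg_div _ _

lemma measureReal_lt_sqrt_sum_le (hB : 0 < B) (hind : iIndepFun Z μ) (hZ : ∀ i, Measurable (Z i))
    (hZB : ∀ i ω, Z i ω ∈ Set.Icc 0 B) {δ : ℝ} (hδ : 0 < δ) :
    μ.real {ω | √(∑ i, μ[Z i]) + δ < √(∑ i, Z i ω)} ≤ Real.exp (-(δ ^ 2 / B)) := by
  set r := √(∑ i, μ[Z i])
  have hu : 0 < r + δ := add_pos_of_nonneg_of_pos (Real.sqrt_nonneg _) hδ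
  obtain ⟨s, hs, -, hs_le⟩ := exists_mul_exp_sub_one_sub_mul_sq_le (Real.sqrt_nonneg _) hu
  calc μ.real {ω | r + δ < √(∑ i, Z i ω)}
      ≤ μ.real {ω | (r + δ) ^ 2 ≤ (∑ i, Z i) ω} := by
        refine measureReal_mono fun ω hω => ?_
        rw [Set.mem_ofPred_eq, Finset.sum_apply]
        exact ((Real.lt_sqrt hu.le).1 hω).le
    _ ≤ Real.exp (-(s / B) * (r + δ) ^ 2) * mgf (∑ i, Z i) μ (s / B) :=
        measure_ge_le_exp_mul_mgf _ (div_nonneg (hs (by linarith)) hB.le)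
          (hind.integrable_exp_mul_sum hZ fun i _ =>
            integrable_exp_mul_of_mem_Icc (hZ i).aemeasurable (ae_of_all _ (hZB i)))
    _ ≤ Real.exp (-((r + δ - r) ^ 2 / B)) := exp_mul_mgf_sum_le hB hind hZ hZB hs_le
    _ = _ := by rw [add_sub_cancel_left]

lemma measureReal_sqrt_sum_lt_le (hB : 0 < B) (hind : iIndepFun Z μ) (hZ : ∀ i, Measurable (Z i))
    (hZB : ∀ i ω, Z i ω ∈ Set.Icc 0 B) {δ : ℝ} (hδ : 0 < δ) :
    μ.real {ω | √(∑ i, Z i ω) < √(∑ i, μ[Z i]) - δ} ≤ Real.exp (-(δ ^ 2 / B)) := by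
  set r := √(∑ i, μ[Z i])
  obtain hr | hu := le_or_gt (r - δ) 0
  · have hempty : {ω | √(∑ i, Z i ω) < r - δ} = ∅ :=
      Set.eq_empty_of_forall_notMem fun ω hω => (hω.trans_le hr).not_ge (Real.sqrt_nonneg _)
    rw [hempty, measureReal_empty]
    positivity
  obtain ⟨s, -, hs, hs_le⟩ := exists_mul_exp_sub_one_sub_mul_sq_le (Real.sqrt_nonneg _) hu
  calc μ.real {ω | √(∑ i, Z i ω) < r - δ}
      ≤ μ.real {ω | (∑ i, Z i) ω ≤ (r - δ) ^ 2} := by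
        refine measureReal_mono fun ω hω => ?_
        rw [Set.mem_ofPred_eq, Finset.sum_apply]
        exact ((Real.sqrt_lt' hu).1 hω).le
    _ ≤ Real.exp (-(s / B) * (r - δ) ^ 2) * mgf (∑ i, Z i) μ (s / B) :=
        measure_le_le_exp_mul_mgf _ (div_nonpos_of_nonpos_of_nonneg (hs (by linarith)) hB.le)
          (hind.integrable_exp_mul_sum hZ fun i _ =>
            integrable_exp_mul_of_mem_Icc (hZ i).aemeasurable (ae_of_all _ (hZB i)))
    _ ≤ Real.exp (-((r - δ - r) ^ 2 / B)) := exp_mul_mgf_sum_le hB hind hZ hZB hs_le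
    _ = _ := by ring_nf

lemma measureReal_lt_abs_sqrt_sum_sub_le (hB : 0 < B) (hind : iIndepFun Z μ)
    (hZ : ∀ i, Measurable (Z i)) (hZB : ∀ i ω, Z i ω ∈ Set.Icc 0 B) {δ : ℝ} (hδ : 0 < δ) :
    μ.real {ω | δ < |√(∑ i, Z i ω) - √(∑ i, μ[Z i])|} ≤ 2 * Real.exp (-(δ ^ 2 / B)) := by
  have hsub : {ω | δ < |√(∑ i, Z i ω) - √(∑ i, μ[Z i])|} ⊆
      {ω | √(∑ i, μ[Z i]) + δ < √(∑ i, Z i ω)} ∪ {ω | √(∑ i, Z i ω) < √(∑ i, μ[Z i]) - δ} := by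
    intro ω hω
    rw [Set.mem_ofPred_eq, lt_abs] at hω
    exact hω.imp lt_sub_iff_add_lt'.1 fun h => by rw [Set.mem_ofPred_eq]; linarith
  linarith [measureReal_mono (μ := μ) hsub, measureReal_lt_sqrt_sum_le hB hind hZ hZB hδ,
    measureReal_sqrt_sum_lt_le hB hind hZ hZB hδ,
    measureReal_union_le (μ := μ) {ω | √(∑ i, μ[Z i]) + δ < √(∑ i, Z i ω)}
      {ω | √(∑ i, Z i ω) < √(∑ i, μ[Z i]) - δ}]

end SqrtSum

section SubGaussian

variable {Ω : Type*} [MeasurableSpace Ω] {μ : Measure Ω} {c : NNReal}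

lemma lintegral_exp_mul_sq_gaussianReal {a : ℝ} (ha : a < 1 / 2) :
    ∫⁻ g, ENNReal.ofReal (Real.exp (a * g ^ 2)) ∂gaussianReal 0 1 =
      ENNReal.ofReal (√(1 - 2 * a))⁻¹ := by
  have hpdf : ∀ g : ℝ, (gaussianPDF 0 1 * fun g => ENNReal.ofReal (Real.exp (a * g ^ 2))) g =
      ENNReal.ofReal ((√(2 * Real.pi))⁻¹ * Real.exp (-(1 / 2 - a) * g ^ 2)) := fun g => by
    simp only [Pi.mul_apply, gaussianPDF, gaussianPDFReal, NNReal.coe_one, mul_one, sub_zero]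
    rw [← ENNReal.ofReal_mul (by positivity), mul_assoc, ← Real.exp_add]
    congr 3
    ring
  have ha' : 0 < 1 / 2 - a := sub_pos.2 ha
  rw [gaussianReal_of_var_ne_zero _ one_ne_zero,
    lintegral_withDensity_eq_lintegral_mul _ (measurable_gaussianPDF _ _) (by fun_prop)]
  simp_rw [hpdf]
  rw [← ofReal_integral_eq_lintegral_ofReal ((integrable_exp_neg_mul_sq ha').const_mul _)
    (ae_of_all _ fun g => by positivity), integral_const_mul, integral_gaussian, ← Real.sqrt_inv,
    ← Real.sqrt_mul (by positivity), ← Real.sqrt_inv]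
  congr 2
  field_simp

lemma lintegral_exp_mul_sq_le_of_hasSubgaussianMGF [SFinite μ] {X : Ω → ℝ}
    (hX : HasSubgaussianMGF X c μ) {κ : ℝ} (hκ : 0 ≤ κ) (hκc : κ * c < 1 / 2) :
    ∫⁻ ω, ENNReal.ofReal (Real.exp (κ * X ω ^ 2)) ∂μ ≤ ENNReal.ofReal (√(1 - 2 * (κ * c)))⁻¹ := by
  set s := √(2 * κ)
  have hs : s ^ 2 = 2 * κ := Real.sq_sqrt (by positivity)
  -- `exp (κ z²)` is an average of exponentials linear in `z`, to which the bound on the moment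
  -- generating function of `X` applies
  have linearize (z : ℝ) : ENNReal.ofReal (Real.exp (κ * z ^ 2)) =
      ∫⁻ g, ENNReal.ofReal (Real.exp (s * g * z)) ∂gaussianReal 0 1 := by
    have hmgf := mgf_gaussianReal (p := gaussianReal 0 1) Measure.map_id (s * z)
    simp only [mgf, id, mul_right_comm s z] at hmgf
    rw [← ofReal_integral_eq_lintegral_ofReal
      (by simpa only [mul_right_comm s z] using integrable_exp_mul_gaussianReal (s * z))
      (ae_of_all _ fun g => (Real.exp_pos _).le), hmgf, mul_pow, hs]
    congr 2
    push_cast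
    ring
  calc ∫⁻ ω, ENNReal.ofReal (Real.exp (κ * X ω ^ 2)) ∂μ
      = ∫⁻ g, ∫⁻ ω, ENNReal.ofReal (Real.exp (s * g * X ω)) ∂μ ∂gaussianReal 0 1 := by
        simp_rw [linearize]
        refine lintegral_lintegral_swap (AEMeasurable.ennreal_ofReal ?_)
        have hX' : AEMeasurable (fun q : Ω × ℝ => X q.1) (μ.prod (gaussianReal 0 1)) :=
          hX.aemeasurable.comp_fst
        exact Real.measurable_exp.comp_aemeasurable
          ((measurable_snd.const_mul s).aemeasurable.mul hX')
    _ ≤ ∫⁻ g, ENNReal.ofReal (Real.exp (κ * c * g ^ 2)) ∂gaussianReal 0 1 := by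
        refine lintegral_mono fun g => ?_
        rw [← ofReal_integral_eq_lintegral_ofReal (hX.integrable_exp_mul _)
          (ae_of_all _ fun ω => (Real.exp_pos _).le)]
        refine ENNReal.ofReal_le_ofReal ((hX.mgf_le (s * g)).trans_eq ?_)
        rw [mul_pow, hs]
        ring_nf
    _ = _ := lintegral_exp_mul_sq_gaussianReal hκc

lemma exp_mul_measureReal_le_mean_sq_le {ι : Type*} [Fintype ι] [Nonempty ι]
    {X : ι → Ω → ℝ} (hX : ∀ i, AEMeasurable (X i) μ) {κ M : ℝ} (hκ : 0 ≤ κ) (hM : 0 ≤ M)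
    (h : ∀ i, ∫⁻ ω, ENNReal.ofReal (Real.exp (κ * X i ω ^ 2)) ∂μ ≤ ENNReal.ofReal M) (t : ℝ) :
    Real.exp (κ * t) * μ.real {ω | t ≤ (Fintype.card ι : ℝ)⁻¹ * ∑ i, X i ω ^ 2} ≤ M := by
  set N : ℝ := (Fintype.card ι : ℝ)
  have hN : 0 < N := Nat.cast_pos.2 Fintype.card_pos
  let E : ι → Ω → ENNReal := fun i ω => ENNReal.ofReal (Real.exp (κ * X i ω ^ 2))
  have hE : ∀ i, AEMeasurable (E i) μ := fun i => by fun_prop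
  have jensen (ω : Ω) : ENNReal.ofReal (Real.exp (κ * (N⁻¹ * ∑ i, X i ω ^ 2))) ≤
      ENNReal.ofReal N⁻¹ * ∑ i, E i ω := by
    have := convexOn_exp.map_sum_le (t := Finset.univ) (w := fun _ => N⁻¹)
      (p := fun i => κ * X i ω ^ 2) (fun _ _ => inv_nonneg.2 hN.le)
      (by simp [N, hN.ne']) fun _ _ => Set.mem_univ _
    simp only [smul_eq_mul, ← Finset.mul_sum, mul_left_comm _ κ] at this
    rw [← ENNReal.ofReal_sum_of_nonneg fun _ _ => by positivity,
      ← ENNReal.ofReal_mul (by positivity)]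
    exact ENNReal.ofReal_le_ofReal this
  have markov : ENNReal.ofReal (Real.exp (κ * t)) * μ {ω | t ≤ N⁻¹ * ∑ i, X i ω ^ 2} ≤
      ENNReal.ofReal M := by
    calc _ ≤ ENNReal.ofReal (Real.exp (κ * t)) *
          μ {ω | ENNReal.ofReal (Real.exp (κ * t)) ≤ ENNReal.ofReal N⁻¹ * ∑ i, E i ω} := by
          gcongr with ω
          refine fun hω => le_trans (ENNReal.ofReal_le_ofReal ?_) (jensen ω)
          gcongr
      _ ≤ ∫⁻ ω, ENNReal.ofReal N⁻¹ * ∑ i, E i ω ∂μ := mul_meas_ge_le_lintegral₀ (by fun_prop) _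
      _ = ENNReal.ofReal N⁻¹ * ∑ i, ∫⁻ ω, E i ω ∂μ := by
          rw [lintegral_const_mul' _ _ ENNReal.ofReal_ne_top,
            lintegral_finsetSum' _ fun i _ => hE i]
      _ ≤ ENNReal.ofReal N⁻¹ * ∑ _i : ι, ENNReal.ofReal M := by gcongr with i; exact h i
      _ = ENNReal.ofReal M := by
          rw [Finset.sum_const, nsmul_eq_mul, Finset.card_univ, ← ENNReal.ofReal_natCast,
            ← ENNReal.ofReal_mul hN.le, ← ENNReal.ofReal_mul (by positivity),
            inv_mul_cancel_left₀ hN.ne']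
  have := ENNReal.toReal_mono ENNReal.ofReal_ne_top markov
  rwa [ENNReal.toReal_mul, ENNReal.toReal_ofReal (Real.exp_pos _).le, ENNReal.toReal_ofReal hM]
    at this

lemma measureReal_le_mean_sq_le_of_hasSubgaussianMGF [SFinite μ] {ι : Type*} [Fintype ι]
    [Nonempty ι] {X : ι → Ω → ℝ} (hX : ∀ i, HasSubgaussianMGF (X i) c μ) (t : ℝ) :
    μ.real {ω | t ≤ (Fintype.card ι : ℝ)⁻¹ * ∑ i, X i ω ^ 2} ≤ 2 * Real.exp (-(t / (4 * c))) := by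
  have hκc : 1 / (4 * (c : ℝ)) * c ≤ 1 / 4 := by
    obtain rfl | hc := eq_or_ne c 0
    · norm_num
    · field_simp
      norm_num
  have hE (i : ι) : ∫⁻ ω, ENNReal.ofReal (Real.exp (1 / (4 * c) * X i ω ^ 2)) ∂μ ≤
      ENNReal.ofReal 2 := by
    refine (lintegral_exp_mul_sq_le_of_hasSubgaussianMGF (hX i) (by positivity) (by linarith)).trans
      (ENNReal.ofReal_le_ofReal (inv_le_of_inv_le₀ two_pos ?_))
    exact Real.le_sqrt_of_sq_le (by linarith)
  have hexp := exp_mul_measureReal_le_mean_sq_le (fun i => (hX i).aemeasurable)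
    (by positivity) zero_le_two hE t
  rwa [Real.exp_neg, ← div_eq_mul_inv, le_div_iff₀' (Real.exp_pos _), ← one_div_mul_eq_div]

lemma hasSubgaussianMGF_of_indepFun {Θ 𝓨 : Type*} [MeasurableSpace Θ] [MeasurableSpace 𝓨]
    [IsProbabilityMeasure μ] {f : Θ → 𝓨 → ℝ} (hf : Measurable f.uncurry) {θ : Ω → Θ} {z : Ω → 𝓨}
    (hθ : Measurable θ) (hz : Measurable z) (hind : IndepFun θ z μ)
    (h : ∀ a, HasSubgaussianMGF (fun ω => f a (z ω)) c μ) :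
    HasSubgaussianMGF (fun ω => f (θ ω) (z ω)) c μ := by
  have := Measure.isProbabilityMeasure_map (μ := μ) hθ.aemeasurable
  have := Measure.isProbabilityMeasure_map (μ := μ) hz.aemeasurable
  have hsec (a : Θ) (s : ℝ) : Integrable (fun y => Real.exp (s * f a y)) (μ.map z) :=
    (integrable_map_measure (by fun_prop) hz.aemeasurable).2 ((h a).integrable_exp_mul s)
  have hsec_le (a : Θ) (s : ℝ) : ∫ y, Real.exp (s * f a y) ∂μ.map z ≤ Real.exp (c * s ^ 2 / 2) := by
    rw [integral_map hz.aemeasurable (by fun_prop)]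
    exact (h a).mgf_le s
  have hint (s : ℝ) : Integrable (fun q : Θ × 𝓨 => Real.exp (s * f.uncurry q))
      ((μ.map θ).prod (μ.map z)) := by
    have hm : StronglyMeasurable fun q : Θ × 𝓨 => Real.exp (s * f.uncurry q) :=
      Measurable.stronglyMeasurable (by fun_prop)
    refine (integrable_prod_iff hm.aestronglyMeasurable).2 ⟨ae_of_all _ fun a => hsec a s, ?_⟩
    simp only [Real.norm_of_nonneg (Real.exp_pos _).le]
    refine .of_bound hm.integral_prod_right'.aestronglyMeasurable
      (Real.exp (c * s ^ 2 / 2)) (ae_of_all _ fun a => ?_)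
    rw [Real.norm_of_nonneg (integral_nonneg fun y => (Real.exp_pos _).le)]
    exact hsec_le a s
  refine HasSubgaussianMGF.of_map (Y := fun ω => (θ ω, z ω)) (X := f.uncurry)
    (hθ.prodMk hz).aemeasurable ?_
  rw [(indepFun_iff_map_prod_eq_prod_map_map hθ.aemeasurable hz.aemeasurable).1 hind]
  refine ⟨hint, fun s => ?_⟩
  rw [mgf, integral_prod _ (hint s)]
  calc _ ≤ ∫ _a : Θ, Real.exp (c * s ^ 2 / 2) ∂μ.map θ :=
        integral_mono (hint s).integral_prod_left (integrable_const _) fun a => hsec_le a s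
    _ = _ := by simp

end SubGaussian

section RandomFeature

variable {Ω Θ 𝓩 H ι κ : Type*} [MeasurableSpace Ω] [MeasurableSpace Θ] [MeasurableSpace 𝓩]
  [NormedAddCommGroup H] [InnerProductSpace ℝ H] {μ : Measure Ω} {ν : Measure Θ} {P Q : Measure 𝓩}
  {ψ : Θ → 𝓩 → ℝ} {B : ℝ} {Φ : 𝓩 → H}

/-- A bounded random feature for the feature map `Φ`: a function `ψ` of a random parameter
`θ ∼ ν` whose correlations `E_θ[ψ_θ(x) ψ_θ(y)]` reproduce the kernel `⟪Φ x, Φ y⟫`. -/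
structure IsRandomFeature (ν : Measure Θ) (ψ : Θ → 𝓩 → ℝ) (Φ : 𝓩 → H) (B : ℝ) : Prop where
  measurable : Measurable ψ.uncurry
  abs_apply_le : ∀ θ z, |ψ θ z| ≤ B
  integral_mul : ∀ x y, ∫ θ, ψ θ x * ψ θ y ∂ν = inner ℝ (Φ x) (Φ y)

/-- The difference of the means of the feature `ψ_θ` under `P` and under `Q`: the contribution of
the parameter `θ` to the distance of the mean embeddings of `P` and `Q`. -/
noncomputable def featureGap (ψ : Θ → 𝓩 → ℝ) (P Q : Measure 𝓩) (θ : Θ) : ℝ :=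
  ∫ z, ψ θ z ∂P - ∫ z, ψ θ z ∂Q

/-- The empirical version of `featureGap` for two samples of the same size. They are encoded as one
family `z`, the sample from `P` on the left summand and the sample from `Q` on the right. -/
noncomputable def sampleGap [Fintype κ] (ψ : Θ → 𝓩 → ℝ) (z : κ ⊕ κ → 𝓩) (θ : Θ) : ℝ :=
  (Fintype.card κ : ℝ)⁻¹ * (∑ j, ψ θ (z (.inl j)) - ∑ j, ψ θ (z (.inr j)))

lemma inner_integral_integral [CompleteSpace H] [SFinite P] [SFinite Q] (hP : Integrable Φ P)
    (hQ : Integrable Φ Q) :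
    inner ℝ (∫ x, Φ x ∂P) (∫ y, Φ y ∂Q) = ∫ q, inner ℝ (Φ q.1) (Φ q.2) ∂P.prod Q :=
  (integral_prod_bilin (innerSL ℝ) hP hQ).symm

namespace IsRandomFeature

lemma measurable_apply (hψ : IsRandomFeature ν ψ Φ B) (θ : Θ) : Measurable (ψ θ) :=
  hψ.measurable.of_uncurry_left

lemma measurable_integral (hψ : IsRandomFeature ν ψ Φ B) [SFinite P] :
    Measurable fun θ => ∫ z, ψ θ z ∂P :=
  hψ.measurable.stronglyMeasurable.integral_prod_right.measurable

lemma measurable_featureGap (hψ : IsRandomFeature ν ψ Φ B) [SFinite P] [SFinite Q] :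
    Measurable (featureGap ψ P Q) :=
  hψ.measurable_integral.sub hψ.measurable_integral

lemma measurable_sampleGap [Fintype κ] (hψ : IsRandomFeature ν ψ Φ B) :
    Measurable fun q : Θ × (κ ⊕ κ → 𝓩) => sampleGap ψ q.2 q.1 := by
  have h (k : κ ⊕ κ) : Measurable fun q : Θ × (κ ⊕ κ → 𝓩) => ψ q.1 (q.2 k) :=
    hψ.measurable.comp (by fun_prop : Measurable fun q : Θ × (κ ⊕ κ → 𝓩) => (q.1, q.2 k))
  exact ((Finset.measurable_fun_sum _ fun j _ => h (.inl j)).sub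
    (Finset.measurable_fun_sum _ fun j _ => h (.inr j))).const_mul _

lemma comp {𝓨 : Type*} [MeasurableSpace 𝓨] (hψ : IsRandomFeature ν ψ Φ B) {f : 𝓨 → 𝓩}
    (hf : Measurable f) : IsRandomFeature ν (fun θ y => ψ θ (f y)) (fun y => Φ (f y)) B where
  measurable := hψ.measurable.comp (by fun_prop : Measurable fun q : Θ × 𝓨 => (q.1, f q.2))
  abs_apply_le θ y := hψ.abs_apply_le θ (f y)
  integral_mul x y := hψ.integral_mul (f x) (f y)

lemma abs_integral_le (hψ : IsRandomFeature ν ψ Φ B) [IsProbabilityMeasure P] (θ : Θ) :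
    |∫ z, ψ θ z ∂P| ≤ B := by
  simpa using norm_integral_le_of_norm_le_const (μ := P) (f := ψ θ) (C := B)
    (ae_of_all _ (hψ.abs_apply_le θ))

variable [IsProbabilityMeasure P] [IsProbabilityMeasure Q]

lemma featureGap_sq_le (hψ : IsRandomFeature ν ψ Φ B) (θ : Θ) :
    featureGap ψ P Q θ ^ 2 ≤ 4 * B ^ 2 := by
  have hPQ : |featureGap ψ P Q θ| ≤ 2 * B := by
    refine (abs_sub _ _).trans ?_
    linarith [hψ.abs_integral_le (P := P) θ, hψ.abs_integral_le (P := Q) θ]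
  calc featureGap ψ P Q θ ^ 2 ≤ (2 * B) ^ 2 := sq_le_sq' (abs_le.1 hPQ).1 (abs_le.1 hPQ).2
    _ = _ := by ring

variable [IsFiniteMeasure ν]

lemma integrable_integral_mul_integral (hψ : IsRandomFeature ν ψ Φ B) :
    Integrable (fun θ => (∫ z, ψ θ z ∂P) * ∫ z, ψ θ z ∂Q) ν := by
  refine .of_bound (hψ.measurable_integral.mul hψ.measurable_integral).aestronglyMeasurable (B * B)
    (ae_of_all _ fun θ => ?_)
  rw [norm_mul]
  exact mul_le_mul (hψ.abs_integral_le θ) (hψ.abs_integral_le θ) (norm_nonneg _)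
    ((abs_nonneg _).trans (hψ.abs_integral_le (P := P) θ))

variable [CompleteSpace H]

lemma inner_integral_integral (hψ : IsRandomFeature ν ψ Φ B) (hP : Integrable Φ P)
    (hQ : Integrable Φ Q) :
    inner ℝ (∫ x, Φ x ∂P) (∫ y, Φ y ∂Q) = ∫ θ, (∫ z, ψ θ z ∂P) * ∫ z, ψ θ z ∂Q ∂ν := by
  have hint : Integrable (Function.uncurry fun (θ : Θ) (q : 𝓩 × 𝓩) => ψ θ q.1 * ψ θ q.2)
      (ν.prod (P.prod Q)) := by
    have hm (g : 𝓩 × 𝓩 → 𝓩) (hg : Measurable g) :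
        Measurable fun r : Θ × 𝓩 × 𝓩 => ψ r.1 (g r.2) :=
      hψ.measurable.comp (by fun_prop : Measurable fun r : Θ × 𝓩 × 𝓩 => (r.1, g r.2))
    refine .of_bound ((hm _ measurable_fst).mul (hm _ measurable_snd)).aestronglyMeasurable (B * B)
      (ae_of_all _ fun ⟨θ, x, y⟩ => ?_)
    rw [Function.uncurry_apply_pair, norm_mul]
    exact mul_le_mul (hψ.abs_apply_le θ x) (hψ.abs_apply_le θ y) (norm_nonneg _)
      ((abs_nonneg _).trans (hψ.abs_apply_le θ x))
  calc inner ℝ (∫ x, Φ x ∂P) (∫ y, Φ y ∂Q)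
      = ∫ q, (∫ θ, ψ θ q.1 * ψ θ q.2 ∂ν) ∂P.prod Q := by
        simp_rw [AutoQD.inner_integral_integral hP hQ, hψ.integral_mul]
    _ = ∫ θ, (∫ q, ψ θ q.1 * ψ θ q.2 ∂P.prod Q) ∂ν := (integral_integral_swap hint).symm
    _ = _ := by simp_rw [integral_prod_mul]

lemma integral_featureGap_sq (hψ : IsRandomFeature ν ψ Φ B) (hP : Integrable Φ P)
    (hQ : Integrable Φ Q) :
    ∫ θ, featureGap ψ P Q θ ^ 2 ∂ν = ‖∫ z, Φ z ∂P - ∫ z, Φ z ∂Q‖ ^ 2 := by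
  have hPP := hψ.integrable_integral_mul_integral (P := P) (Q := P)
  have hPQ := hψ.integrable_integral_mul_integral (P := P) (Q := Q)
  have hQQ := hψ.integrable_integral_mul_integral (P := Q) (Q := Q)
  rw [norm_sub_sq_real, ← real_inner_self_eq_norm_sq, ← real_inner_self_eq_norm_sq,
    hψ.inner_integral_integral hP hP, hψ.inner_integral_integral hP hQ,
    hψ.inner_integral_integral hQ hQ, ← integral_const_mul,
    ← integral_sub hPP (hPQ.const_mul 2), ← integral_add (by exact hPP.sub (hPQ.const_mul 2)) hQQ]
  congr with θ
  rw [featureGap]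
  ring

end IsRandomFeature

lemma hasSubgaussianMGF_sum_sub_integral [IsProbabilityMeasure μ] [Fintype κ] {X : κ → Ω → ℝ}
    {a b : ℝ} (hind : iIndepFun X μ) (hX : ∀ k, Measurable (X k))
    (hXab : ∀ k ω, X k ω ∈ Set.Icc a b) :
    HasSubgaussianMGF (fun ω => ∑ k, (X k ω - μ[X k])) (Fintype.card κ * (‖b - a‖₊ / 2) ^ 2) μ := by
  have hcentered : iIndepFun (fun k ω => X k ω - μ[X k]) μ :=
    hind.comp (fun (k : κ) (t : ℝ) => t - ∫ ω, X k ω ∂μ) fun _ => measurable_id.sub_const _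
  simpa using HasSubgaussianMGF.sum_of_iIndepFun hcentered (s := Finset.univ)
    fun k _ => hasSubgaussianMGF_of_mem_Icc (hX k).aemeasurable (ae_of_all _ (hXab k))

variable [IsProbabilityMeasure μ] [Fintype κ] [Nonempty κ] {z : κ ⊕ κ → Ω → 𝓩}

lemma IsRandomFeature.hasSubgaussianMGF_sampleGap_sub (hψ : IsRandomFeature ν ψ Φ B)
    (hz : ∀ k, Measurable (z k)) (hzP : ∀ j, μ.map (z (.inl j)) = P)
    (hzQ : ∀ j, μ.map (z (.inr j)) = Q) (hind : iIndepFun z μ) (θ : Θ) :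
    HasSubgaussianMGF (fun ω => sampleGap ψ (z · ω) θ - featureGap ψ P Q θ)
      (2 * ‖B‖₊ ^ 2 / Fintype.card κ) μ := by
  have hf := hψ.measurable_apply θ
  let g : κ ⊕ κ → 𝓩 → ℝ := Sum.elim (fun _ => ψ θ) fun _ => -ψ θ
  have hg : ∀ k, Measurable (g k) := by rintro (_ | _); exacts [hf, hf.neg]
  have hgB : ∀ k ω, g k (z k ω) ∈ Set.Icc (-B) B := by
    rintro (j | j) ω
    exacts [abs_le.1 (hψ.abs_apply_le θ _), abs_le.1 ((abs_neg _).trans_le (hψ.abs_apply_le θ _))]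
  have hsum := (hasSubgaussianMGF_sum_sub_integral (hind.comp g hg)
    (fun k => (hg k).comp (hz k)) hgB).const_mul (Fintype.card κ : ℝ)⁻¹
  have hP (j : κ) : ∫ ω, ψ θ (z (.inl j) ω) ∂μ = ∫ t, ψ θ t ∂P := by
    rw [← hzP j, integral_map (hz _).aemeasurable hf.aestronglyMeasurable]
  have hQ (j : κ) : ∫ ω, ψ θ (z (.inr j) ω) ∂μ = ∫ t, ψ θ t ∂Q := by
    rw [← hzQ j, integral_map (hz _).aemeasurable hf.aestronglyMeasurable]
  have hκ : (Fintype.card κ : ℝ) ≠ 0 := Nat.cast_ne_zero.2 Fintype.card_ne_zero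
  convert hsum using 1
  · ext ω
    simp only [Fintype.sum_sum_type, Function.comp_apply, g, Sum.elim_inl, Sum.elim_inr,
      Pi.neg_apply, integral_neg, hP, hQ, Finset.sum_sub_distrib, Finset.sum_neg_distrib,
      Finset.sum_const, Finset.card_univ, nsmul_eq_mul, sampleGap, featureGap]
    field_simp
    ring
  · ext
    change 2 * ‖B‖ ^ 2 / Fintype.card κ =
      (Fintype.card κ : ℝ)⁻¹ ^ 2 * (Fintype.card (κ ⊕ κ) * (‖B - -B‖ / 2) ^ 2)
    rw [sub_neg_eq_add, ← two_mul, norm_mul, Real.norm_two, Fintype.card_sum, Nat.cast_add]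
    field_simp
    ring

lemma abs_sqrt_mean_sq_sub_sqrt_mean_sq_le [Fintype ι] (u v : ι → ℝ) :
    |√((Fintype.card ι : ℝ)⁻¹ * ∑ i, u i ^ 2) - √((Fintype.card ι : ℝ)⁻¹ * ∑ i, v i ^ 2)| ≤
      √((Fintype.card ι : ℝ)⁻¹ * ∑ i, (u i - v i) ^ 2) := by
  have h := abs_norm_sub_norm_le (WithLp.toLp 2 u : EuclideanSpace ℝ ι) (WithLp.toLp 2 v)
  simp only [EuclideanSpace.norm_eq, PiLp.sub_apply, Real.norm_eq_abs, sq_abs] at h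
  simp only [Real.sqrt_mul (inv_nonneg.2 (Nat.cast_nonneg _)), ← mul_sub, abs_mul,
    abs_of_nonneg (Real.sqrt_nonneg _)]
  gcongr

variable [Fintype ι] [Nonempty ι] [IsProbabilityMeasure P] [IsProbabilityMeasure Q]
  {θ : ι → Ω → Θ}

namespace IsRandomFeature

lemma measureReal_lt_abs_sqrt_mean_featureGap_sq_sub_le [CompleteSpace H]
    (hψ : IsRandomFeature ν ψ Φ B) (hB : 0 < B) (hP : Integrable Φ P) (hQ : Integrable Φ Q)
    (hθ : ∀ i, Measurable (θ i)) (hθν : ∀ i, μ.map (θ i) = ν) (hind : iIndepFun θ μ)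
    {δ : ℝ} (hδ : 0 < δ) :
    μ.real {ω | δ < |√((Fintype.card ι : ℝ)⁻¹ * ∑ i, featureGap ψ P Q (θ i ω) ^ 2) -
      ‖∫ z, Φ z ∂P - ∫ z, Φ z ∂Q‖|} ≤ 2 * Real.exp (-(Fintype.card ι * δ ^ 2 / (4 * B ^ 2))) := by
  have : IsProbabilityMeasure ν :=
    hθν (Classical.arbitrary ι) ▸ Measure.isProbabilityMeasure_map (hθ _).aemeasurable
  have hι : 0 < (Fintype.card ι : ℝ) := Nat.cast_pos.2 Fintype.card_pos
  have hgap : Measurable fun t => (Fintype.card ι : ℝ)⁻¹ * featureGap ψ P Q t ^ 2 :=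
    (hψ.measurable_featureGap.pow_const 2).const_mul _
  have hmean : ∑ i, ∫ ω, (Fintype.card ι : ℝ)⁻¹ * featureGap ψ P Q (θ i ω) ^ 2 ∂μ =
      ‖∫ z, Φ z ∂P - ∫ z, Φ z ∂Q‖ ^ 2 := by
    have hlaw (i : ι) : ∫ ω, (Fintype.card ι : ℝ)⁻¹ * featureGap ψ P Q (θ i ω) ^ 2 ∂μ =
        (Fintype.card ι : ℝ)⁻¹ * ‖∫ z, Φ z ∂P - ∫ z, Φ z ∂Q‖ ^ 2 := by
      rw [← hψ.integral_featureGap_sq hP hQ, ← integral_const_mul, ← hθν i,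
        integral_map (hθ i).aemeasurable hgap.aestronglyMeasurable]
    simp only [hlaw, Finset.sum_const, Finset.card_univ, nsmul_eq_mul,
      mul_inv_cancel_left₀ hι.ne']
  have hconc := measureReal_lt_abs_sqrt_sum_sub_le (B := 4 * B ^ 2 / Fintype.card ι)
    (by positivity) (hind.comp _ fun _ => hgap) (fun i => hgap.comp (hθ i))
    (fun i ω => ⟨mul_nonneg (by positivity) (sq_nonneg _), by
      rw [Function.comp_apply, ← div_eq_inv_mul]
      gcongr
      exact hψ.featureGap_sq_le _⟩) hδ
  simp only [Function.comp_apply, ← Finset.mul_sum] at hconc hmean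
  rwa [hmean, Real.sqrt_sq (norm_nonneg _), div_div_eq_mul_div, mul_comm (δ ^ 2)] at hconc

lemma measureReal_le_mean_sampleGap_sub_sq_le (hψ : IsRandomFeature ν ψ Φ B)
    (hθ : ∀ i, Measurable (θ i)) (hz : ∀ k, Measurable (z k))
    (hzP : ∀ j, μ.map (z (.inl j)) = P) (hzQ : ∀ j, μ.map (z (.inr j)) = Q)
    (hind : iIndepFun z μ) (hθz : ∀ i, IndepFun (θ i) (fun ω k => z k ω) μ) (t : ℝ) :
    μ.real {ω | t ≤ (Fintype.card ι : ℝ)⁻¹ *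
      ∑ i, (sampleGap ψ (z · ω) (θ i ω) - featureGap ψ P Q (θ i ω)) ^ 2} ≤
      2 * Real.exp (-(Fintype.card κ * t / (8 * B ^ 2))) := by
  have hsub (i : ι) := hasSubgaussianMGF_of_indepFun
    (f := fun a y => sampleGap ψ y a - featureGap ψ P Q a)
    (hψ.measurable_sampleGap.sub (hψ.measurable_featureGap.comp measurable_fst))
    (hθ i) (measurable_pi_lambda _ hz) (hθz i)
    (hψ.hasSubgaussianMGF_sampleGap_sub hz hzP hzQ hind)
  convert measureReal_le_mean_sq_le_of_hasSubgaussianMGF hsub t using 4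
  push_cast
  rw [Real.norm_eq_abs, sq_abs, ← mul_div_assoc, div_div_eq_mul_div, ← mul_assoc, mul_comm t]
  norm_num

lemma measureReal_le_abs_sqrt_mean_sampleGap_sq_sub_le [CompleteSpace H]
    (hψ : IsRandomFeature ν ψ Φ B) (hB : 0 < B) (hP : Integrable Φ P) (hQ : Integrable Φ Q)
    (hθ : ∀ i, Measurable (θ i)) (hθν : ∀ i, μ.map (θ i) = ν) (hindθ : iIndepFun θ μ)
    (hz : ∀ k, Measurable (z k)) (hzP : ∀ j, μ.map (z (.inl j)) = P)
    (hzQ : ∀ j, μ.map (z (.inr j)) = Q) (hindz : iIndepFun z μ)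
    (hθz : ∀ i, IndepFun (θ i) (fun ω k => z k ω) μ) {η δ : ℝ} (hη : 0 < η) (hδ : 0 < δ) :
    μ.real {ω | η + δ ≤ |√((Fintype.card ι : ℝ)⁻¹ * ∑ i, sampleGap ψ (z · ω) (θ i ω) ^ 2) -
      ‖∫ z, Φ z ∂P - ∫ z, Φ z ∂Q‖|} ≤
      2 * Real.exp (-(Fintype.card κ * η ^ 2 / (8 * B ^ 2))) +
        2 * Real.exp (-(Fintype.card ι * δ ^ 2 / (4 * B ^ 2))) := by
  refine le_trans ?_ (add_le_add
    (hψ.measureReal_le_mean_sampleGap_sub_sq_le hθ hz hzP hzQ hindz hθz (η ^ 2))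
    (hψ.measureReal_lt_abs_sqrt_mean_featureGap_sq_sub_le hB hP hQ hθ hθν hindθ hδ))
  refine (measureReal_mono fun ω hω => ?_).trans (measureReal_union_le _ _)
  rw [Set.mem_union, Set.mem_ofPred_eq, Set.mem_ofPred_eq, or_iff_not_imp_right, not_lt]
  intro hfeature
  have htriangle := abs_sub_le
    √((Fintype.card ι : ℝ)⁻¹ * ∑ i, sampleGap ψ (z · ω) (θ i ω) ^ 2)
    √((Fintype.card ι : ℝ)⁻¹ * ∑ i, featureGap ψ P Q (θ i ω) ^ 2)
    ‖∫ z, Φ z ∂P - ∫ z, Φ z ∂Q‖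
  have hsample := abs_sqrt_mean_sq_sub_sqrt_mean_sq_le
    (fun i => sampleGap ψ (z · ω) (θ i ω)) fun i => featureGap ψ P Q (θ i ω)
  rw [Set.mem_ofPred_eq] at hω
  exact (Real.le_sqrt' hη).1 (by linarith)

end IsRandomFeature

end RandomFeature

section CosineFeature

variable {d : ℕ}

lemma norm_gaussianFeature (σ : ℝ) (x : EuclideanSpace ℝ (Fin d)) : ‖gaussianFeature σ x‖ = 1 := by
  have hsq : ‖gaussianFeature σ x‖ ^ 2 = 1 := by
    rw [← real_inner_self_eq_norm_sq, inner_gaussianFeature, gaussianKernel]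
    simp
  exact (pow_eq_one_iff_of_nonneg (norm_nonneg _) two_ne_zero).1 hsq

lemma continuous_gaussianFeature (σ : ℝ) :
    Continuous (gaussianFeature σ : EuclideanSpace ℝ (Fin d) → _) := by
  refine continuous_iff_continuousAt.2 fun x => tendsto_iff_norm_sub_tendsto_zero.2 ?_
  have hnorm (y : EuclideanSpace ℝ (Fin d)) : ‖gaussianFeature σ y - gaussianFeature σ x‖ =
      √(2 - 2 * gaussianKernel σ y x) := by
    rw [← Real.sqrt_sq (norm_nonneg (_ - _)), norm_sub_sq_real, norm_gaussianFeature,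
      norm_gaussianFeature, inner_gaussianFeature]
    ring_nf
  simp_rw [hnorm]
  have hcont : Continuous fun y => √(2 - 2 * gaussianKernel σ y x) := by
    unfold gaussianKernel
    fun_prop
  simpa [gaussianKernel] using hcont.tendsto x

lemma integrable_gaussianFeature_comp {𝓩 : Type*} [MeasurableSpace 𝓩] {P : Measure 𝓩}
    [IsFiniteMeasure P] (σ : ℝ) {f : 𝓩 → EuclideanSpace ℝ (Fin d)} (hf : Measurable f) :
    Integrable (fun z => gaussianFeature σ (f z)) P :=
  .of_bound ((continuous_gaussianFeature σ).comp_aestronglyMeasurable hf.aestronglyMeasurable) 1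
    (ae_of_all _ fun z => (norm_gaussianFeature σ (f z)).le)

/-- The uniform distribution on `(0, 2π)`, the law of the offsets. -/
noncomputable abbrev uniformAngle : Measure ℝ :=
  ProbabilityTheory.cond volume (Set.Ioo 0 (2 * Real.pi))

instance : IsProbabilityMeasure uniformAngle :=
  cond_isProbabilityMeasure_of_finite (by simp [Real.pi_pos])
    (by rw [Real.volume_Ioo]; exact ENNReal.ofReal_ne_top)

/-- The joint law of a frequency and an offset of the random Fourier features. -/
noncomputable def featureLaw (d : ℕ) (σ : ℝ) : Measure (EuclideanSpace ℝ (Fin d) × ℝ) :=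
  (multivariateGaussian 0 ((σ ^ 2)⁻¹ • (1 : Matrix (Fin d) (Fin d) ℝ))).prod uniformAngle

instance (d : ℕ) (σ : ℝ) : IsProbabilityMeasure (featureLaw d σ) := by
  unfold featureLaw
  infer_instance

/-- The random Fourier feature with frequency `θ.1` and offset `θ.2`. The factor `√2` makes its
correlations equal to the Gaussian kernel; `fourierFeatures` carries an additional `1 / √D`. -/
noncomputable def cosineFeature (θ : EuclideanSpace ℝ (Fin d) × ℝ)
    (x : EuclideanSpace ℝ (Fin d)) : ℝ :=
  √2 * Real.cos (inner ℝ θ.1 x + θ.2)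

lemma integral_cos_two_mul_add_uniformAngle (a : ℝ) :
    ∫ t, Real.cos (2 * t + a) ∂uniformAngle = 0 := by
  have hperiod : Real.sin (2 * (2 * Real.pi) + a) = Real.sin a := by
    rw [add_comm]
    exact_mod_cast Real.sin_add_nat_mul_two_pi a 2
  rw [uniformAngle, ProbabilityTheory.cond, integral_smul_measure, ← integral_Ioc_eq_integral_Ioo,
    ← intervalIntegral.integral_of_le (by positivity),
    intervalIntegral.integral_comp_mul_add (fun t => Real.cos t) two_ne_zero, integral_cos, hperiod]
  simp

lemma integral_two_mul_cos_mul_cos_uniformAngle (a c : ℝ) :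
    ∫ t, 2 * (Real.cos (a + t) * Real.cos (c + t)) ∂uniformAngle = Real.cos (a - c) := by
  have hprod (t : ℝ) : 2 * (Real.cos (a + t) * Real.cos (c + t)) =
      Real.cos (a - c) + Real.cos (2 * t + (a + c)) := by
    rw [← mul_assoc, Real.two_mul_cos_mul_cos]
    ring_nf
  simp_rw [hprod]
  rw [integral_add (integrable_const _)
    (.of_bound (by fun_prop) 1 (ae_of_all _ fun t => Real.abs_cos_le_one _)),
    integral_cos_two_mul_add_uniformAngle]
  simp

lemma integral_cos_inner_eq_re_charFun {E : Type*} [NormedAddCommGroup E] [InnerProductSpace ℝ E]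
    [MeasurableSpace E] [OpensMeasurableSpace E] {μ : Measure E} [IsFiniteMeasure μ] (t : E) :
    ∫ w, Real.cos (inner ℝ w t) ∂μ = (charFun μ t).re := by
  have hint : Integrable (fun w => Complex.exp (inner ℝ w t * Complex.I)) μ :=
    .of_bound (by fun_prop) 1 (ae_of_all _ fun w => (Complex.norm_exp_ofReal_mul_I _).le)
  simpa only [charFun_apply, RCLike.re_to_complex, Complex.exp_ofReal_mul_I_re] using
    integral_re hint

lemma integral_cos_inner_multivariateGaussian (σ : ℝ) (x y : EuclideanSpace ℝ (Fin d)) :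
    ∫ w, Real.cos (inner ℝ w (x - y))
      ∂(multivariateGaussian 0 ((σ ^ 2)⁻¹ • (1 : Matrix (Fin d) (Fin d) ℝ))) =
      gaussianKernel σ x y := by
  have hS : ((σ ^ 2)⁻¹ • (1 : Matrix (Fin d) (Fin d) ℝ)).PosSemidef :=
    Matrix.PosSemidef.one.smul (by positivity)
  rw [integral_cos_inner_eq_re_charFun, charFun_multivariateGaussian hS, inner_zero_right,
    gaussianKernel, EuclideanSpace.real_norm_sq_eq, ← Complex.exp_ofReal_re, Matrix.smul_mulVec,
    dotProduct_smul, Matrix.one_mulVec, dotProduct]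
  congr 2
  simp only [smul_eq_mul, ← sq]
  push_cast
  ring

lemma isRandomFeature_cosineFeature (d : ℕ) (σ : ℝ) :
    IsRandomFeature (featureLaw d σ) cosineFeature (gaussianFeature σ) √2 where
  measurable := by
    unfold cosineFeature Function.uncurry
    fun_prop
  abs_apply_le θ x := by
    rw [cosineFeature, abs_mul, abs_of_nonneg (Real.sqrt_nonneg _)]
    exact mul_le_of_le_one_right (Real.sqrt_nonneg _) (Real.abs_cos_le_one _)
  integral_mul x y := by
    have hmul (θ : EuclideanSpace ℝ (Fin d) × ℝ) : cosineFeature θ x * cosineFeature θ y =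
        2 * (Real.cos (inner ℝ θ.1 x + θ.2) * Real.cos (inner ℝ θ.1 y + θ.2)) := by
      rw [cosineFeature, cosineFeature, mul_mul_mul_comm, Real.mul_self_sqrt zero_le_two]
    simp_rw [hmul]
    rw [inner_gaussianFeature, featureLaw, integral_prod]
    · simp_rw [integral_two_mul_cos_mul_cos_uniformAngle, ← inner_sub_right]
      exact integral_cos_inner_multivariateGaussian σ x y
    · refine .of_bound (by fun_prop) 2 (ae_of_all _ fun θ => ?_)
      rw [norm_mul, norm_mul, Real.norm_two]
      exact mul_le_of_le_one_right zero_le_two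
        (mul_le_one₀ (Real.abs_cos_le_one _) (norm_nonneg _) (Real.abs_cos_le_one _))

lemma norm_embedding_sub_embedding {D n : ℕ} (w : Fin D → EuclideanSpace ℝ (Fin d))
    (b : Fin D → ℝ) (x : Fin n ⊕ Fin n → EuclideanSpace ℝ (Fin d)) :
    ‖embedding w b (fun j => x (.inl j)) - embedding w b fun j => x (.inr j)‖ =
      √((D : ℝ)⁻¹ * ∑ i, sampleGap cosineFeature x (w i, b i) ^ 2) := by
  have hcoord (i : Fin D) :
      (embedding w b (fun j => x (.inl j)) - embedding w b fun j => x (.inr j)) i =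
        √(D : ℝ)⁻¹ * sampleGap cosineFeature x (w i, b i) := by
    simp only [embedding, fourierFeatures, sampleGap, cosineFeature, PiLp.sub_apply,
      PiLp.smul_apply, WithLp.ofLp_sum, Finset.sum_apply, smul_eq_mul, ← Finset.mul_sum,
      div_eq_mul_inv, Real.sqrt_mul zero_le_two, one_mul, Fintype.card_fin]
    ring
  rw [EuclideanSpace.norm_eq]
  simp_rw [hcoord, norm_mul, mul_pow, Real.norm_eq_abs, sq_abs, ← Finset.mul_sum]
  rw [Real.sq_sqrt (by positivity)]

end CosineFeature

section Independence

variable {Ω ι κ : Type*} {mΩ : MeasurableSpace Ω} {μ : Measure Ω}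

lemma iIndep_iSup_of_disjoint {m : ι → MeasurableSpace Ω} (h_le : ∀ i, m i ≤ mΩ)
    (h : iIndep m μ) {S : κ → Set ι} (hS : Pairwise (Function.onFun Disjoint S)) :
    iIndep (fun k => ⨆ i ∈ S k, m i) μ := by
  classical
  have := h.isProbabilityMeasure
  refine (iIndep_iff _ _).2 fun s f hf => ?_
  induction s using Finset.induction_on with
  | empty => simp
  | insert a s ha ih =>
    have hdisj : Disjoint (S a) (⋃ k ∈ s, S k) :=
      Set.disjoint_iUnion₂_right.2 fun k hk => hS (ne_of_mem_of_not_mem hk ha).symm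
    have hinter : MeasurableSet[⨆ i ∈ ⋃ k ∈ s, S k, m i] (⋂ k ∈ s, f k) :=
      Finset.measurableSet_biInter s fun k hk => by
        have hle : ⨆ i ∈ S k, m i ≤ ⨆ i ∈ ⋃ k ∈ s, S k, m i :=
          biSup_mono fun _ hi => Set.mem_biUnion hk hi
        exact hle _ (hf k (Finset.mem_insert_of_mem hk))
    rw [Finset.set_biInter_insert, Finset.prod_insert ha,
      ← ih fun k hk => hf k (Finset.mem_insert_of_mem hk)]
    exact (Indep_iff _ _ _).1 (indep_iSup_of_disjoint h_le h hdisj) _ _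
      (hf a (Finset.mem_insert_self a s)) hinter

end Independence

section Draw

variable {Ω 𝓩 : Type*} {mΩ : MeasurableSpace Ω} [MeasurableSpace 𝓩] {μ : Measure Ω} {σ : ℝ}
  {d D n : ℕ} {P Q : Measure 𝓩} {w : Fin D → Ω → EuclideanSpace ℝ (Fin d)} {b : Fin D → Ω → ℝ}
  {x y : Fin n → Ω → 𝓩}

/-- The σ-algebras generated by the single draws, indexed as in `IsDraw.indep`. -/
abbrev drawSigma (w : Fin D → Ω → EuclideanSpace ℝ (Fin d)) (b : Fin D → Ω → ℝ)
    (x y : Fin n → Ω → 𝓩) : (Fin D ⊕ Fin D) ⊕ (Fin n ⊕ Fin n) → MeasurableSpace Ω :=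
  Sum.elim
    (Sum.elim (fun i => MeasurableSpace.comap (w i) inferInstance)
      (fun i => MeasurableSpace.comap (b i) inferInstance))
    (Sum.elim (fun j => MeasurableSpace.comap (x j) inferInstance)
      (fun j => MeasurableSpace.comap (y j) inferInstance))

lemma comap_frequency_offset_eq_iSup_drawSigma (i : Fin D) :
    MeasurableSpace.comap (fun ω => (w i ω, b i ω)) inferInstance =
      ⨆ k ∈ ({.inl (.inl i), .inl (.inr i)} : Set ((Fin D ⊕ Fin D) ⊕ (Fin n ⊕ Fin n))),
        drawSigma w b x y k := by
  rw [iSup_pair]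
  exact MeasurableSpace.comap_prodMk _ _

namespace IsDraw

lemma drawSigma_le (h : IsDraw μ σ P Q w b x y) (k) : drawSigma w b x y k ≤ mΩ := by
  obtain (i | i) | (j | j) := k
  exacts [(h.measurable_w i).comap_le, (h.measurable_b i).comap_le, (h.measurable_x j).comap_le,
    (h.measurable_y j).comap_le]

lemma measurable_sample (h : IsDraw μ σ P Q w b x y) (k : Fin n ⊕ Fin n) :
    Measurable (Sum.elim x y k) := by
  obtain j | j := k
  exacts [h.measurable_x j, h.measurable_y j]

lemma map_frequency_offset (h : IsDraw μ σ P Q w b x y) (i : Fin D) :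
    μ.map (fun ω => (w i ω, b i ω)) = featureLaw d σ := by
  have := h.indep.isProbabilityMeasure
  have hind : IndepFun (w i) (b i) μ :=
    h.indep.indep (i := .inl (.inl i)) (j := .inl (.inr i)) (by simp)
  rw [(indepFun_iff_map_prod_eq_prod_map_map (h.measurable_w i).aemeasurable
    (h.measurable_b i).aemeasurable).1 hind, h.law_w, h.law_b, featureLaw]

lemma iIndepFun_frequency_offset (h : IsDraw μ σ P Q w b x y) :
    iIndepFun (fun i ω => (w i ω, b i ω)) μ := by
  rw [iIndepFun_iff_iIndep]
  simp_rw [comap_frequency_offset_eq_iSup_drawSigma (x := x) (y := y)]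
  exact iIndep_iSup_of_disjoint h.drawSigma_le h.indep fun i j hij => by
    simp [Function.onFun, hij.symm]

lemma iIndepFun_sample (h : IsDraw μ σ P Q w b x y) : iIndepFun (Sum.elim x y) μ := by
  rw [iIndepFun_iff_iIndep]
  convert h.indep.precomp Sum.inr_injective using 1
  ext1 (j | j) <;> rfl

lemma indepFun_frequency_offset_sample (h : IsDraw μ σ P Q w b x y) (i : Fin D) :
    IndepFun (fun ω => (w i ω, b i ω)) (fun ω k => Sum.elim x y k ω) μ := by
  have hsample : MeasurableSpace.comap (fun ω k => Sum.elim x y k ω) inferInstance =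
      ⨆ k ∈ Set.range Sum.inr, drawSigma w b x y k := by
    rw [MeasurableSpace.comap_process_pi, iSup_range]
    refine iSup_congr ?_
    rintro (j | j) <;> rfl
  rw [IndepFun_iff_Indep, comap_frequency_offset_eq_iSup_drawSigma (x := x) (y := y), hsample]
  refine indep_iSup_of_disjoint h.drawSigma_le h.indep ?_
  simp

end IsDraw

end Draw


section Embedding

lemma measurable_stateActionVec {p q : ℕ} {S : Set (EuclideanSpace ℝ (Fin p))}
    {A : Set (EuclideanSpace ℝ (Fin q))} :
    Measurable (stateActionVec : S × A → EuclideanSpace ℝ (Fin (p + q))) := by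
  refine (PiLp.continuous_toLp 2 _).measurable.comp (measurable_pi_iff.2 fun i => ?_)
  refine Fin.addCases (fun i => ?_) (fun j => ?_) i
  · simp only [Fin.append_left]
    fun_prop
  · simp only [Fin.append_right]
    fun_prop

variable {d : ℕ} {𝓩 : Type*} [MeasurableSpace 𝓩]

lemma MMD_map (σ : ℝ) {P Q : Measure 𝓩} {f : 𝓩 → EuclideanSpace ℝ (Fin d)} (hf : Measurable f) :
    MMD σ (P.map f) (Q.map f) =
      ‖∫ z, gaussianFeature σ (f z) ∂P - ∫ z, gaussianFeature σ (f z) ∂Q‖ := by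
  rw [MMD,
    integral_map hf.aemeasurable (continuous_gaussianFeature σ).aestronglyMeasurable,
    integral_map hf.aemeasurable (continuous_gaussianFeature σ).aestronglyMeasurable]

end Embedding

lemma exp_neg_le_one_div {x : ℝ} (hx : 0 < x) : Real.exp (-x) ≤ 1 / x := by
  rw [Real.exp_neg, ← one_div]
  exact one_div_le_one_div_of_le hx (by linarith [Real.add_one_le_exp x])

lemma deviation_bound_le {D : ℕ} (n d : ℕ) (hD : 0 < D) {ε : ℝ} (hε : 0 < ε) :
    2 * Real.exp (-(n * (ε / 4) ^ 2 / 16)) + 2 * Real.exp (-(D * (ε / 2) ^ 2 / 8)) ≤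
      2 * Real.exp (-(n * (1 / 256) * ε ^ 2)) +
        128 * (1 / ε ^ 2 * Real.exp (-(D * ε ^ 2) / (64 * ((d : ℝ) + 2)))) +
        6 * Real.exp (-(n * ε ^ 2) / 8) := by
  have hD' : (1 : ℝ) ≤ D := Nat.one_le_cast.2 hD
  have hpoly : Real.exp (-(D * ε ^ 2 / 64)) ≤ 64 * (1 / ε ^ 2) :=
    calc Real.exp (-(D * ε ^ 2 / 64)) ≤ 1 / (D * ε ^ 2 / 64) := exp_neg_le_one_div (by positivity)
      _ ≤ 1 / (1 * ε ^ 2 / 64) := by gcongr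
      _ = 64 * (1 / ε ^ 2) := by field_simp
  have hdim : Real.exp (-(D * ε ^ 2 / 64)) ≤ Real.exp (-(D * ε ^ 2) / (64 * ((d : ℝ) + 2))) := by
    rw [Real.exp_le_exp, neg_div, neg_le_neg_iff]
    gcongr
    linarith [d.cast_nonneg (α := ℝ)]
  have hfeatures : 2 * Real.exp (-(D * (ε / 2) ^ 2 / 8)) ≤
      128 * (1 / ε ^ 2 * Real.exp (-(D * ε ^ 2) / (64 * ((d : ℝ) + 2)))) :=
    calc 2 * Real.exp (-(D * (ε / 2) ^ 2 / 8))
        = 2 * (Real.exp (-(D * ε ^ 2 / 64)) * Real.exp (-(D * ε ^ 2 / 64))) := by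
          rw [← Real.exp_add]
          ring_nf
      _ ≤ 2 * (64 * (1 / ε ^ 2) * Real.exp (-(D * ε ^ 2) / (64 * ((d : ℝ) + 2)))) := by gcongr
      _ = _ := by ring
  have hsample : n * (ε / 4) ^ 2 / 16 = n * (1 / 256) * ε ^ 2 := by ring
  rw [hsample]
  linarith [Real.exp_pos (-(n * ε ^ 2) / 8)]

end AutoQD

theorem theorem1_general {d D n : ℕ} {σ : ℝ} (_hσ : 0 < σ) (hD : 0 < D) (hn : 0 < n)
    {Ω 𝓩 : Type*} [MeasurableSpace Ω] [MeasurableSpace 𝓩] {μ : Measure Ω} {ρ₁ ρ₂ : Measure 𝓩}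
    [IsProbabilityMeasure μ] [IsProbabilityMeasure ρ₁] [IsProbabilityMeasure ρ₂]
    {f : 𝓩 → EuclideanSpace ℝ (Fin d)} (hf : Measurable f)
    {w : Fin D → Ω → EuclideanSpace ℝ (Fin d)} {b : Fin D → Ω → ℝ} {x y : Fin n → Ω → 𝓩}
    (hdraw : AutoQD.IsDraw μ σ ρ₁ ρ₂ w b x y) {η δ : ℝ} (hη : 0 < η) (hδ : 0 < δ) :
    μ.real {ω | η + δ ≤
        |‖AutoQD.embedding (fun i => w i ω) (fun i => b i ω) (fun j => f (x j ω))
            - AutoQD.embedding (fun i => w i ω) (fun i => b i ω) (fun j => f (y j ω))‖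
          - AutoQD.MMD σ (ρ₁.map f) (ρ₂.map f)|}
      ≤ 2 * Real.exp (-(n * η ^ 2 / 16)) + 2 * Real.exp (-(D * δ ^ 2 / 8)) := by
  have : Nonempty (Fin D) := Fin.pos_iff_nonempty.1 hD
  have : Nonempty (Fin n) := Fin.pos_iff_nonempty.1 hn
  have hdev := ((AutoQD.isRandomFeature_cosineFeature d σ).comp
    hf).measureReal_le_abs_sqrt_mean_sampleGap_sq_sub_le (by positivity)
    (AutoQD.integrable_gaussianFeature_comp σ hf) (AutoQD.integrable_gaussianFeature_comp σ hf)
    (fun i => (hdraw.measurable_w i).prodMk (hdraw.measurable_b i)) hdraw.map_frequency_offset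
    hdraw.iIndepFun_frequency_offset hdraw.measurable_sample hdraw.law_x hdraw.law_y
    hdraw.iIndepFun_sample hdraw.indepFun_frequency_offset_sample hη hδ
  have hnorm (ω : Ω) := AutoQD.norm_embedding_sub_embedding (fun i => w i ω) (fun i => b i ω)
    fun k => f (Sum.elim x y k ω)
  simp only [Sum.elim_inl, Sum.elim_inr] at hnorm
  simp only [hnorm, AutoQD.MMD_map σ hf]
  rwa [Real.sq_sqrt zero_le_two, (by norm_num : (8 : ℝ) * 2 = 16), (by norm_num : (4 : ℝ) * 2 = 8),
    Fintype.card_fin, Fintype.card_fin] at hdev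

theorem theorem1 :
    ∃ c : ℝ, 0 < c ∧ ∃ C : ℝ, 0 < C ∧
      ∀ (p q : ℕ) (S : Set (EuclideanSpace ℝ (Fin p))) (A : Set (EuclideanSpace ℝ (Fin q)))
        (M : AutoQD.MDP S A) (π₁ π₂ : Kernel S A) [IsMarkovKernel π₁] [IsMarkovKernel π₂]
        (σ : ℝ) (_hσ : 0 < σ) (D n : ℕ) (_hD : 0 < D) (_hn : 0 < n)
        (Ω : Type*) [MeasurableSpace Ω] (μ : Measure Ω) [IsProbabilityMeasure μ]
        (w : Fin D → Ω → EuclideanSpace ℝ (Fin (p + q))) (b : Fin D → Ω → ℝ)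
        (x y : Fin n → Ω → S × A)
        (_hdraw : AutoQD.IsDraw μ σ (M.occupancy π₁) (M.occupancy π₂) w b x y)
        (ε : ℝ) (_hε : 0 < ε),
        μ.real {ω | 3 / 4 * ε ≤
            |‖AutoQD.embedding (fun i => w i ω) (fun i => b i ω)
                  (fun j => AutoQD.stateActionVec (x j ω))
                - AutoQD.embedding (fun i => w i ω) (fun i => b i ω)
                  (fun j => AutoQD.stateActionVec (y j ω))‖
              - AutoQD.MMD σ ((M.occupancy π₁).map AutoQD.stateActionVec)
                  ((M.occupancy π₂).map AutoQD.stateActionVec)|}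
          ≤ 2 * Real.exp (-(n * c * ε ^ 2))
            + C * (1 / ε ^ 2 * Real.exp (-(D * ε ^ 2) / (64 * (((p + q : ℕ) : ℝ) + 2))))
            + 6 * Real.exp (-(n * ε ^ 2) / 8) := by
  refine ⟨1 / 256, by norm_num, 128, by norm_num, fun p q S A M π₁ π₂ _ _ σ hσ D n hD hn Ω _ μ _
    w b x y hdraw ε hε => ?_⟩
  rw [show 3 / 4 * ε = ε / 4 + ε / 2 by ring]
  exact (theorem1_general hσ hD hn AutoQD.measurable_stateActionVec hdraw (by positivity)
    (by positivity)).trans (AutoQD.deviation_bound_le n (p + q) hD hε)
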